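/- There are universal constants $c, C > 0$ such that the following holds for all integers $d \ge 1$ and all reals $R \ge 0$, $\varepsilon > 0$. There are an integer $N \ge 0$ with $$N \le C\Bigl( (cR)^d + \max\Bigl\{\log\frac{\sqrt d}{\varepsilon},\, 0\Bigr\}\Bigr)$$ and a randomized, adaptive algorithm (depending only on $d, R, \varepsilon$) which makes at most $N$ queries to an oracle that, queried at $x \in \mathbb{R}^d$, returns $(V(x), \nabla V(x))$, such that for every $V : \mathbb{R}^d \to \mathbb{R}$ satisfying 1. $V(0) = 0$, 2. $V(x) = \frac12 (\|x\| - R)^2$ whenever $\|x\| \ge R$, 3. $V$ is $1$-smooth, i.e. $V$ is differentiable and $\|\nabla V(x) - \nabla V(y)\| \le \|x-y\|$ for all $x, y \in \mathbb{R}^d$, the law $\mu$ of the output of the algorithm satisfies $\sqrt{\mathrm{FI}(\mu \,\|\, \pi)} \le \varepsilon$. Here $\pi$ is the probability measure on $\mathbb{R}^d$ with density proportional to $\exp(-V)$, and $\mathrm{FI}(\mu \,\|\, \pi) = \mathbb{E}_\mu\bigl[\|\nabla \ln \frac{\mathrm{d}\mu}{\mathrm{d}\pi}\|^2\bigr]$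 is the relative Fisher information (with a weak gradient; $+\infty$ if $\mu$ has no weakly differentiable density). -/

import Mathlib

open MeasureTheory
open scoped ENNReal ContDiff

noncomputable section

namespace FisherSampling

/-- The Euclidean space `ℝ^d`. -/
abbrev E (d : ℕ) : Type := EuclideanSpace ℝ (Fin d)

/-- `g` is the weak (distributional) gradient of the locally integrable function `f` on `ℝ^d`. -/
def IsWeakGradient {d : ℕ} (f : E d → ℝ) (g : E d → E d) : Prop :=
  LocallyIntegrable f volume ∧ LocallyIntegrable g volume ∧
    ∀ φ : E d → ℝ, ContDiff ℝ ∞ φ → HasCompactSupport φ →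
      ∫ x, f x • gradient φ x = - ∫ x, φ x • g x

/-- The density `dμ/dπ`, as a real-valued function. -/
def densityRatio {d : ℕ} (μ π : Measure (E d)) (x : E d) : ℝ := (μ.rnDeriv π x).toReal

open Classical in
/-- The relative Fisher information `FI(μ ‖ π) = 𝔼_μ ‖∇ ln (μ/π)‖²` of `μ` from `π`, where `π` has
a positive locally Lipschitz Lebesgue density. Here `∇ ln ρ = ρ⁻¹ ∇ρ` with the weak gradient of
`ρ = dμ/dπ`, which is unique up to null sets (so that the infimum has at most one value); the value
is `∞` if `μ` is not absolutely continuous or if `ρ` has no weak gradient. -/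
def fisherInfo {d : ℕ} (μ π : Measure (E d)) : ℝ≥0∞ :=
  if μ ≪ π then
    ⨅ (g : E d → E d) (_ : IsWeakGradient (densityRatio μ π) g),
      ∫⁻ x, ‖(densityRatio μ π x)⁻¹ • g x‖ₑ ^ 2 ∂μ
  else ⊤

/-- The probability measure `π ∝ exp (-V)` on `ℝ^d`. -/
def gibbs {d : ℕ} (V : E d → ℝ) : Measure (E d) := volume.tilted (fun x => -V x)

/-- `V` is `1`-smooth: it is differentiable and its gradient is `1`-Lipschitz. -/
def OneSmooth {d : ℕ} (V : E d → ℝ) : Prop :=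
  Differentiable ℝ V ∧ LipschitzWith 1 (gradient V)

/-- The potentials of effective support in the ball of radius `R`: `V 0 = 0`, the function `V`
equals `½ (‖x‖ - R)²` for `‖x‖ ≥ R`, and `V` is `1`-smooth. -/
structure IsBoundedSupportPotential {d : ℕ} (R : ℝ) (V : E d → ℝ) : Prop where
  zero : V 0 = 0
  outside : ∀ x : E d, R ≤ ‖x‖ → V x = (1 / 2) * (‖x‖ - R) ^ 2
  smooth : OneSmooth V

/-- The local oracle for `V`: queried at `x`, it returns `(V x, ∇V x)`. -/
def localOracle {d : ℕ} (V : E d → ℝ) (x : E d) : ℝ × E d := (V x, gradient V x)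

/-- A randomized adaptive sampling algorithm on `ℝ^d` making `N` oracle queries. It draws a random
seed; the `k`-th query point is a measurable function of the seed and the answers to the previous
`k` queries; the output is a measurable function of the seed and the `N` answers. The algorithm has
no other access to the target. (An algorithm that may stop earlier is covered by repeating
queries, so `N` is a bound on the number of queries in every run.) -/
structure SamplingAlgorithm (d N : ℕ) where
  /-- The space of random seeds. -/
  Seed : Type
  [seedSpace : MeasurableSpace Seed]
  /-- The law of the random seed. -/
  seedLaw : Measure Seed
  [seedProb : IsProbabilityMeasure seedLaw]
  /-- The `k`-th query point; only the first `N` of these are used. -/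
  query : (k : ℕ) → Seed × (Fin k → ℝ × E d) → E d
  query_measurable : ∀ k, Measurable (query k)
  /-- The output. -/
  output : Seed × (Fin N → ℝ × E d) → E d
  output_measurable : Measurable output

attribute [instance] SamplingAlgorithm.seedSpace SamplingAlgorithm.seedProb

namespace SamplingAlgorithm

variable {d N : ℕ}

/-- The first `k` answers received when the algorithm runs with seed `s` on the given oracle. -/
def transcript (A : SamplingAlgorithm d N) (oracle : E d → ℝ × E d) (s : A.Seed) :
    (k : ℕ) → (Fin k → ℝ × E d)
  | 0 => Fin.elim0
  | k + 1 => Fin.snoc (A.transcript oracle s k) (oracle (A.query k (s, A.transcript oracle s k)))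

/-- The output of the run with seed `s` on the given oracle. -/
def run (A : SamplingAlgorithm d N) (oracle : E d → ℝ × E d) (s : A.Seed) : E d :=
  A.output (s, A.transcript oracle s N)

/-- The law of the output when the algorithm runs on the given oracle. -/
def outputLaw (A : SamplingAlgorithm d N) (oracle : E d → ℝ × E d) : Measure (E d) :=
  A.seedLaw.map (A.run oracle)

theorem measurable_transcript (A : SamplingAlgorithm d N) {oracle : E d → ℝ × E d}
    (h : Measurable oracle) (k : ℕ) : Measurable (fun s => A.transcript oracle s k) := by
  induction k with
  | zero => exact measurable_pi_iff.2 fun i => i.elim0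
  | succ k ih =>
    refine measurable_pi_iff.2 fun i => ?_
    refine Fin.lastCases ?_ (fun j => ?_) i
    · simp only [transcript, Fin.snoc_last]
      exact h.comp ((A.query_measurable k).comp (measurable_id.prodMk ih))
    · simp only [transcript, Fin.snoc_castSucc]
      exact (measurable_pi_apply j).comp ih

theorem measurable_run (A : SamplingAlgorithm d N) {oracle : E d → ℝ × E d}
    (h : Measurable oracle) : Measurable (A.run oracle) :=
  A.output_measurable.comp (measurable_id.prodMk (A.measurable_transcript h N))

theorem isProbabilityMeasure_outputLaw (A : SamplingAlgorithm d N) {oracle : E d → ℝ × E d}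
    (h : Measurable oracle) : IsProbabilityMeasure (A.outputLaw oracle) :=
  Measure.isProbabilityMeasure_map (A.measurable_run h).aemeasurable

end SamplingAlgorithm

theorem measurable_localOracle {d : ℕ} {V : E d → ℝ} (h : OneSmooth V) :
    Measurable (localOracle V) :=
  h.1.continuous.measurable.prodMk h.2.continuous.measurable

end FisherSampling

end

/-! Outside the ball of radius `R` the potential is known. Inside, about `(1 + 2R)^d` queries at the
centres of a cover by unit balls determine `V` up to an additive error `1` by first-order Taylor
expansion (`OneSmooth.abs_sub_taylor_le`). This gives an explicit `q` with `exp (-V) ≤ q ≤ e² exp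
(-V)`, so rejection sampling from `q` accepts each trial with probability at least `e⁻²`. If `M`
trials all fail, a standard Gaussian `γ` is output, and the law is exactly `s π + t γ` with `t ≤ (1
- e⁻²)^M` (`outputLaw_rejectionSampler`).

The Fisher information of such a mixture is linear in `t` (`fisherInfo_mixture_gaussianLaw_le`).
With `h = dγ/dπ`, the ratio `ρ = s + t h` has gradient `t h (∇V - x)`, and `t h ≤ ρ` gives `‖∇ρ‖²/ρ
≤ t h ‖∇V - x‖²`. Since `‖∇V - x‖ ≤ R` everywhere and `∫ h dπ = 1`, the information is at most `t
R²`. Hence `M` of order `log (R/ε)` is enough, and the `log R` in it is absorbed by `(3R)^d`. -/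

open scoped NNReal

noncomputable section

namespace FisherSampling

/-! ### Covering a ball by unit balls -/

section

/-- Volume comparison: the balls of radius `1/2` about the points are disjoint and lie in the ball
of radius `R + 1/2`. -/
theorem card_le_of_isSeparated {d : ℕ} {R : ℝ} (hR : 0 ≤ R) (s : Finset (E d))
    (hs : (s : Set (E d)) ⊆ Metric.closedBall 0 R)
    (hsep : Metric.IsSeparated ((1 : ℝ≥0) : ℝ≥0∞) (s : Set (E d))) :
    (s.card : ℝ) ≤ (1 + 2 * R) ^ d := by
  have hdisj : (s : Set (E d)).PairwiseDisjoint fun x => Metric.ball x (1 / 2 : ℝ) := by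
    intro x hx y hy hxy
    refine Metric.ball_disjoint_ball ?_
    have h : (1 : ℝ≥0∞) < edist x y := hsep hx hy hxy
    rw [edist_dist, ← ENNReal.ofReal_one,
      ENNReal.ofReal_lt_ofReal_iff_of_nonneg zero_le_one] at h
    linarith
  have hsub : (⋃ x ∈ s, Metric.ball x (1 / 2 : ℝ)) ⊆ Metric.closedBall (0 : E d) (R + 1 / 2) := by
    refine Set.iUnion₂_subset fun x hx =>
      (Metric.ball_subset_closedBall).trans (Metric.closedBall_subset_closedBall' ?_)
    have := Metric.mem_closedBall.1 (hs hx)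
    linarith
  have hvol := measure_mono (μ := (volume : Measure (E d))) hsub
  rw [measure_biUnion_finset hdisj fun x _ => Metric.isOpen_ball.measurableSet] at hvol
  simp_rw [Measure.addHaar_ball_of_pos volume _ (show (0 : ℝ) < 1 / 2 by norm_num)] at hvol
  rw [Measure.addHaar_closedBall volume _ (by linarith), Finset.sum_const, nsmul_eq_mul,
    ← mul_assoc, finrank_euclideanSpace_fin,
    ENNReal.mul_le_mul_iff_left (Metric.measure_ball_pos volume _ one_pos).ne'
      measure_ball_lt_top.ne, ← ENNReal.ofReal_natCast, ← ENNReal.ofReal_mul (by positivity),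
    ENNReal.ofReal_le_ofReal_iff (by positivity)] at hvol
  have h2 : (1 + 2 * R) ^ d = (R + 1 / 2) ^ d * 2 ^ d := by
    rw [← mul_pow]; ring
  rw [h2]
  calc (s.card : ℝ) = s.card * (1 / 2) ^ d * 2 ^ d := by
        rw [mul_assoc, ← mul_pow]; norm_num
    _ ≤ _ := by gcongr

/-- The ball of radius `R` is covered by at most `(1 + 2R)^d` balls of radius `1`. -/
theorem exists_cover_closedBall (d : ℕ) {R : ℝ} (hR : 0 ≤ R) :
    ∃ n : ℕ, 0 < n ∧ (n : ℝ) ≤ (1 + 2 * R) ^ d ∧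
      ∃ x : Fin n → E d, ∀ y, ‖y‖ ≤ R → ∃ i, ‖y - x i‖ ≤ 1 := by
  have hpack : Metric.packingNumber 1 (Metric.closedBall (0 : E d) R) ≤
      (⌊(1 + 2 * R) ^ d⌋₊ : ℕ∞) := by
    refine iSup_le fun C => iSup₂_le fun hC hsep => ?_
    by_contra! hlt
    -- `C` may be infinite, so a subset with exactly one point too many is used.
    obtain ⟨t, htC, ht⟩ := Set.exists_subset_encard_eq (Order.add_one_le_of_lt hlt)
    have htfin : t.Finite :=
      Set.finite_of_encard_eq_coe (k := ⌊(1 + 2 * R) ^ d⌋₊ + 1) (by simpa using ht)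
    lift t to Finset (E d) using htfin
    have := card_le_of_isSeparated hR t (htC.trans hC) (hsep.mono htC)
    rw [Set.encard_coe_eq_coe_finsetCard] at ht
    have h1 : t.card = ⌊(1 + 2 * R) ^ d⌋₊ + 1 := by exact_mod_cast ht
    have h2 := Nat.le_floor this
    omega
  have hcov := (Metric.coveringNumber_le_packingNumber 1 _).trans hpack
  obtain ⟨C, -, hfin, hC, hcard⟩ :=
    Metric.exists_set_encard_eq_coveringNumber (hcov.trans_lt (ENat.natCast_lt_top _)).ne
  rw [← hcard] at hcov
  lift C to Finset (E d) using hfin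
  rw [Set.encard_coe_eq_coe_finsetCard] at hcov
  have hcov' : C.card ≤ ⌊(1 + 2 * R) ^ d⌋₊ := by exact_mod_cast hcov
  have key : ∀ y : E d, ‖y‖ ≤ R → ∃ z ∈ C, ‖y - z‖ ≤ 1 := by
    intro y hy
    obtain ⟨z, hz, hyz⟩ := hC (show y ∈ Metric.closedBall (0 : E d) R by simpa using hy)
    have h : edist y z ≤ 1 := hyz
    rw [edist_dist, dist_eq_norm, ENNReal.ofReal_le_one] at h
    exact ⟨z, hz, h⟩
  refine ⟨C.card, ?_, (Nat.le_floor_iff (by positivity)).1 hcov', fun i => C.equivFin.symm i, ?_⟩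
  · obtain ⟨z, hz, -⟩ := key 0 (by simpa using hR)
    exact Finset.card_pos.2 ⟨z, hz⟩
  · intro y hy
    obtain ⟨z, hz, h⟩ := key y hy
    exact ⟨C.equivFin ⟨z, hz⟩, by simpa using h⟩

end

/-! ### Estimates on the potential -/

section

variable {d : ℕ} {R : ℝ} {V : E d → ℝ}

/-- Mean value inequality: on the unit ball about `y` the gradient differs from `gradient V y` by at
most `1`. The sharper constant `1/2` is not needed. -/
theorem OneSmooth.abs_sub_taylor_le (hV : OneSmooth V) {x y : E d} (h : ‖x - y‖ ≤ 1) :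
    |V x - (V y + inner ℝ (gradient V y) (x - y))| ≤ 1 := by
  have hd : ∀ z ∈ Metric.closedBall y 1, HasFDerivWithinAt V
      (InnerProductSpace.toDual ℝ (E d) (gradient V z)) (Metric.closedBall y 1) z :=
    fun z _ => (hV.1 z).hasGradientAt.hasFDerivAt.hasFDerivWithinAt
  have hb : ∀ z ∈ Metric.closedBall y (1 : ℝ), ‖InnerProductSpace.toDual ℝ (E d) (gradient V z) -
      InnerProductSpace.toDual ℝ (E d) (gradient V y)‖ ≤ 1 := by
    intro z hz
    rw [← map_sub, LinearIsometryEquiv.norm_map, ← dist_eq_norm]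
    have := hV.2.dist_le_mul z y
    have hz' := Metric.mem_closedBall.1 hz
    simp only [NNReal.coe_one, one_mul] at this
    exact this.trans hz'
  have := (convex_closedBall y 1).norm_image_sub_le_of_norm_hasFDerivWithin_le' hd hb
    (Metric.mem_closedBall_self zero_le_one)
    (show x ∈ Metric.closedBall y 1 by simpa [dist_eq_norm] using h)
  rw [InnerProductSpace.toDual_apply_apply, one_mul, Real.norm_eq_abs] at this
  rw [← sub_sub]
  exact this.trans h

theorem hasGradientAt_half_norm_sub_sq (R : ℝ) {x : E d} (hx : x ≠ 0) :
    HasGradientAt (fun y : E d => (1 / 2) * (‖y‖ - R) ^ 2) (x - (R / ‖x‖) • x) x := by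
  have hn : ‖x‖ ≠ 0 := norm_ne_zero_iff.2 hx
  have h1 : HasFDerivAt (fun y : E d => ‖y‖) ((1 / ‖x‖) • innerSL ℝ x) x := by
    have h := ((hasStrictFDerivAt_norm_sq x).hasFDerivAt).sqrt (by positivity)
    simp only [Real.sqrt_sq (norm_nonneg _)] at h
    refine h.congr_fderiv (ContinuousLinearMap.ext fun y => ?_)
    simp only [smul_apply, innerSL_apply_apply, smul_eq_mul, nsmul_eq_mul]
    field_simp
    simp
  have h2 := ((h1.sub_const R).pow 2).const_mul (1 / 2 : ℝ)
  rw [hasGradientAt_iff_hasFDerivAt]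
  refine h2.congr_fderiv (ContinuousLinearMap.ext fun y => ?_)
  simp only [smul_apply, innerSL_apply_apply, smul_eq_mul, nsmul_eq_mul,
    InnerProductSpace.toDual_apply_apply, inner_sub_left, real_inner_smul_left]
  field_simp
  simp

/-- Outside the ball, `∇V x - x = -R x/‖x‖` has norm exactly `R`. Inside, `x` is compared with a
point of its ray just beyond the sphere, where the gradient is explicit, using that `∇V` is
1-Lipschitz. -/
theorem IsBoundedSupportPotential.norm_gradient_sub_le (hV : IsBoundedSupportPotential R V)
    (hR : 0 ≤ R) (hd : 1 ≤ d) (x : E d) : ‖gradient V x - x‖ ≤ R := by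
  have hout : ∀ y : E d, R < ‖y‖ → gradient V y = y - (R / ‖y‖) • y := by
    intro y hy
    refine HasGradientAt.gradient ?_
    refine (hasGradientAt_half_norm_sub_sq R
      (norm_pos_iff.1 (hR.trans_lt hy))).congr_of_eventuallyEq ?_
    filter_upwards [(isOpen_lt continuous_const continuous_norm).mem_nhds hy] with z hz
    exact hV.outside z (le_of_lt hz)
  obtain ⟨u, hu, hxu⟩ : ∃ u : E d, ‖u‖ = 1 ∧ x = ‖x‖ • u := by
    by_cases hx : x = 0
    · have : Nonempty (Fin d) := ⟨⟨0, hd⟩⟩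
      obtain ⟨u, hu⟩ := exists_norm_eq (E d) zero_le_one
      exact ⟨u, hu, by simp [hx]⟩
    · have hn : ‖x‖ ≠ 0 := norm_ne_zero_iff.2 hx
      exact ⟨‖x‖⁻¹ • x, by simp [norm_smul, hn], by simp [smul_smul, hn]⟩
  refine le_of_forall_gt_imp_ge_of_dense fun s hs => ?_
  rcases lt_or_ge R ‖x‖ with hx | hx
  · rw [hout x hx, sub_sub_cancel_left, norm_neg, norm_smul, Real.norm_eq_abs,
      abs_of_nonneg (by positivity), div_mul_cancel₀ _ (hR.trans_lt hx).ne']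
    exact hs.le
  -- The two distances below are at most `s' - ‖x‖` and `s' - R + ‖x‖`, with sum `2s' - R = s`.
  -- Taking `s' > R` strictly keeps the point in the open region where the formula can be
  -- differentiated.
  · have hs0 : 0 < (s + R) / 2 := by linarith
    set s' := (s + R) / 2 with hs'
    have hnorm : ‖s' • u‖ = s' := by rw [norm_smul, hu, Real.norm_eq_abs, abs_of_pos hs0, mul_one]
    have h1 : gradient V (s' • u) = (s' - R) • u := by
      rw [hout _ (by rw [hnorm]; linarith), hnorm, smul_smul, div_mul_cancel₀ _ hs0.ne', sub_smul]
    have h2 := hV.smooth.2.dist_le_mul x (s' • u)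
    rw [dist_eq_norm, dist_eq_norm, h1, NNReal.coe_one, one_mul] at h2
    have h3 : ‖x - s' • u‖ ≤ s' - ‖x‖ := by
      nth_rewrite 1 [hxu]
      rw [← sub_smul, norm_smul, hu, mul_one, Real.norm_eq_abs, abs_sub_comm, abs_of_nonneg]
      linarith
    have h4 : ‖(s' - R) • u - x‖ ≤ |(s' - R) - ‖x‖| := by
      nth_rewrite 1 [hxu]
      rw [← sub_smul, norm_smul, hu, mul_one, Real.norm_eq_abs]
    have h5 : ‖gradient V x - x‖ ≤ ‖gradient V x - (s' - R) • u‖ + ‖(s' - R) • u - x‖ :=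
      norm_sub_le_norm_sub_add_norm_sub _ _ _
    have h6 : |(s' - R) - ‖x‖| ≤ (s' - R) + ‖x‖ := by
      have := norm_nonneg x
      rw [abs_le]; constructor <;> linarith
    linarith

theorem integrable_exp_neg_mul_sq_norm {b : ℝ} (hb : 0 < b) :
    Integrable fun x : E d => Real.exp (-b * ‖x‖ ^ 2) := by
  have h := (GaussianFourier.integrable_cexp_neg_mul_sq_norm_add (V := E d) (b := (b : ℂ))
    (by simpa using hb) 0 0).norm
  refine h.congr (Filter.Eventually.of_forall fun x => ?_)
  simp only [inner_zero_left, Complex.norm_exp]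
  congr 1
  simp [← Complex.ofReal_pow]

theorem IsBoundedSupportPotential.integrable_exp_neg (hV : IsBoundedSupportPotential R V) :
    Integrable fun x => Real.exp (-V x) := by
  have hcont : Continuous V := hV.smooth.1.continuous
  obtain ⟨B, hB⟩ := (isCompact_closedBall (0 : E d) R).bddBelow_image hcont.continuousOn
  -- With `r = ‖x‖ ≥ R`, `-(r - R)²/2 + r²/4 = R²/2 - (r - 2R)²/4`; inside the ball, compactness
  -- bounds `V` below.
  have hlow : ∀ x, -V x ≤ (R ^ 2 + |B| + R ^ 2 / 4) + -(1 / 4) * ‖x‖ ^ 2 := by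
    intro x
    have hBa := neg_abs_le B
    rcases le_or_gt R ‖x‖ with hx | hx
    · rw [hV.outside x hx]
      nlinarith [sq_nonneg (‖x‖ - 2 * R), abs_nonneg B]
    · have h1 : B ≤ V x := hB ⟨x, by simpa using hx.le, rfl⟩
      have h2 : ‖x‖ ^ 2 ≤ R ^ 2 := pow_le_pow_left₀ (norm_nonneg x) hx.le 2
      nlinarith [sq_nonneg R]
  refine Integrable.mono' (((integrable_exp_neg_mul_sq_norm (d := d)
    (show (0 : ℝ) < 1 / 4 by norm_num)).const_mul (Real.exp (R ^ 2 + |B| + R ^ 2 / 4))))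
    (by fun_prop) (Filter.Eventually.of_forall fun x => ?_)
  rw [Real.norm_eq_abs, abs_of_pos (Real.exp_pos _), ← Real.exp_add]
  exact Real.exp_le_exp.2 (hlow x)

end

/-! ### Weak gradients and the Fisher information of a mixture -/

section

variable {d : ℕ}

theorem IsWeakGradient.congr_ae {f f' : E d → ℝ} {g : E d → E d} (h : IsWeakGradient f g)
    (hf : f =ᵐ[volume] f') : IsWeakGradient f' g := by
  refine ⟨h.1.congr hf, h.2.1, fun φ hφ hφc => ?_⟩
  rw [← h.2.2 φ hφ hφc]
  refine integral_congr_ae ?_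
  filter_upwards [hf] with x hx
  rw [hx]

/-- The gradient of a `C¹` function is its weak gradient. -/
theorem isWeakGradient_gradient {f : E d → ℝ} (hf : Differentiable ℝ f)
    (hg : Continuous (gradient f)) : IsWeakGradient f (gradient f) := by
  refine ⟨hf.continuous.locallyIntegrable, hg.locallyIntegrable, fun φ hφ hφc => ?_⟩
  have hφd : Differentiable ℝ φ := hφ.differentiable (by simp)
  have hφf : Continuous (fderiv ℝ φ) := hφ.continuous_fderiv (by simp)
  have hφg : Continuous (gradient φ) :=
    (InnerProductSpace.toDual ℝ (E d)).symm.continuous.comp hφf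
  have hgc : HasCompactSupport (gradient φ) :=
    (hφc.fderiv (𝕜 := ℝ)).comp_left (map_zero (InnerProductSpace.toDual ℝ (E d)).symm)
  have hi1 : Integrable fun x => f x • gradient φ x :=
    (hf.continuous.smul hφg).integrable_of_hasCompactSupport hgc.smul_left
  have hi2 : Integrable fun x => φ x • gradient f x :=
    (hφ.continuous.smul hg).integrable_of_hasCompactSupport hφc.smul_right
  have hgr : ∀ (u : E d → ℝ) (_ : Differentiable ℝ u) (x v : E d),
      fderiv ℝ u x v = inner ℝ v (gradient u x) := by
    intro u hu x v
    rw [real_inner_comm, ← InnerProductSpace.toDual_apply_apply,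
      ← (hu x).hasGradientAt.hasFDerivAt.fderiv]
  -- Pairing with a fixed `v` reduces the claim to scalar integration by parts in the direction `v`.
  refine ext_inner_left ℝ fun v => ?_
  rw [inner_neg_right, ← integral_inner hi1, ← integral_inner hi2]
  have hi1' := hi1.const_inner (𝕜 := ℝ) v
  have hi2' := hi2.const_inner (𝕜 := ℝ) v
  simp only [real_inner_smul_right, ← hgr φ hφd, ← hgr f hf] at hi1' hi2' ⊢
  simp only [mul_comm (φ _)] at hi2' ⊢
  refine integral_mul_fderiv_eq_neg_fderiv_mul_of_integrable hi2' hi1' ?_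
    (fun x _ => hf x) (fun x _ => hφd x)
  exact (hf.continuous.mul hφ.continuous).integrable_of_hasCompactSupport hφc.mul_left

/-- The standard Gaussian law. -/
def gaussianLaw (d : ℕ) : Measure (E d) := gibbs fun x => (1 / 2) * ‖x‖ ^ 2

theorem integrable_exp_neg_half_sq :
    Integrable fun x : E d => Real.exp (-((1 / 2) * ‖x‖ ^ 2)) := by
  simpa [neg_mul] using integrable_exp_neg_mul_sq_norm (d := d) (show (0 : ℝ) < 1 / 2 by norm_num)

instance : IsProbabilityMeasure (gaussianLaw d) :=
  isProbabilityMeasure_tilted integrable_exp_neg_half_sq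

theorem gibbs_eq_withDensity_gibbs {V W : E d → ℝ} (hVm : Measurable V) (hWm : Measurable W)
    (hV : Integrable fun x => Real.exp (-V x)) (hW : Integrable fun x => Real.exp (-W x)) :
    ∃ c : ℝ, 0 < c ∧
      gibbs W = (gibbs V).withDensity fun x => ENNReal.ofReal (c * Real.exp (V x - W x)) := by
  have hZV := integral_exp_pos hV
  have hZW := integral_exp_pos hW
  refine ⟨(∫ x, Real.exp (-V x)) / ∫ x, Real.exp (-W x), div_pos hZV hZW, ?_⟩
  rw [gibbs, gibbs, Measure.tilted, Measure.tilted, ← withDensity_mul _ (by fun_prop) (by fun_prop)]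
  congr 1
  ext x
  rw [Pi.mul_apply, ← ENNReal.ofReal_mul (by positivity)]
  congr 1
  rw [show -W x = -V x + (V x - W x) by ring, Real.exp_add]
  field_simp

/-- The bound needs no control on the size of `dγ/dπ`: one factor `t h` is cancelled by `ρ ≥ t h`,
and the other integrates to `t`. -/
theorem fisherInfo_mixture_gaussianLaw_le {V : E d → ℝ} {R : ℝ} (hV : OneSmooth V)
    (hint : Integrable fun x => Real.exp (-V x)) (hR : ∀ x, ‖gradient V x - x‖ ≤ R)
    {s t : ℝ} (hs : 0 ≤ s) (ht : 0 ≤ t) :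
    fisherInfo (ENNReal.ofReal s • gibbs V + ENNReal.ofReal t • gaussianLaw d) (gibbs V) ≤
      ENNReal.ofReal (t * R ^ 2) := by
  have hVc : Continuous V := hV.1.continuous
  have : IsProbabilityMeasure (gibbs V) := isProbabilityMeasure_tilted hint
  obtain ⟨c, hc, hcW⟩ := gibbs_eq_withDensity_gibbs (W := fun x : E d => (1 / 2) * ‖x‖ ^ 2)
    hVc.measurable (by fun_prop) hint integrable_exp_neg_half_sq
  change gaussianLaw d = _ at hcW
  set h : E d → ℝ := fun x => c * Real.exp (V x - (1 / 2) * ‖x‖ ^ 2) with hh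
  set r : E d → ℝ := fun x => s + t * h x with hr
  have hh0 : ∀ x, 0 < h x := fun x => by positivity
  have hr0 : ∀ x, 0 ≤ r x := fun x => add_nonneg hs (mul_nonneg ht (hh0 x).le)
  have hhm : Measurable h := by fun_prop
  have hrm : Measurable r := by fun_prop
  have hμ : ENNReal.ofReal s • gibbs V + ENNReal.ofReal t • gaussianLaw d =
      (gibbs V).withDensity fun x => ENNReal.ofReal (r x) := by
    rw [hcW, ← withDensity_const, ← withDensity_smul _ (by fun_prop),
      ← withDensity_add_left (by fun_prop)]
    congr 1
    ext x
    simp only [Pi.add_apply, Pi.smul_apply, smul_eq_mul]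
    rw [← ENNReal.ofReal_mul ht, ← ENNReal.ofReal_add hs (mul_nonneg ht (hh0 x).le)]
  have hρ : densityRatio (ENNReal.ofReal s • gibbs V + ENNReal.ofReal t • gaussianLaw d) (gibbs V)
      =ᵐ[gibbs V] r := by
    rw [hμ]
    filter_upwards [Measure.rnDeriv_withDensity (gibbs V) hrm.ennreal_ofReal] with x hx
    rw [densityRatio, hx, ENNReal.toReal_ofReal (hr0 x)]
  have hgrad : ∀ x, HasGradientAt r ((t * h x) • (gradient V x - x)) x := by
    intro x
    have h1 := (hV.1 x).hasGradientAt.hasFDerivAt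
    have h2 := (hasStrictFDerivAt_norm_sq x).hasFDerivAt.const_mul (1 / 2 : ℝ)
    have h3 := ((((h1.sub h2).exp).const_mul c).const_mul t).const_add s
    refine hasGradientAt_iff_hasFDerivAt.2 (h3.congr_fderiv (ContinuousLinearMap.ext fun y => ?_))
    simp only [smul_apply, sub_apply, Pi.sub_apply, innerSL_apply_apply, smul_eq_mul,
      nsmul_eq_mul, InnerProductSpace.toDual_apply_apply, inner_sub_left, real_inner_smul_left, hh,
      Nat.cast_ofNat]
    ring
  have hgr : gradient r = fun x => (t * h x) • (gradient V x - x) := gradient_eq hgrad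
  have hweak : IsWeakGradient r (gradient r) := by
    refine isWeakGradient_gradient (fun x => (hgrad x).differentiableAt) ?_
    rw [hgr]
    have := hV.2.continuous
    fun_prop
  have hac : ENNReal.ofReal s • gibbs V + ENNReal.ofReal t • gaussianLaw d ≪ gibbs V := by
    rw [hμ]
    exact withDensity_absolutelyContinuous _ _
  -- The density of `π` is positive, so `π`-null sets are Lebesgue null and the smooth `r` may
  -- replace the ratio in the weak gradient.
  have hρ' : densityRatio (ENNReal.ofReal s • gibbs V + ENNReal.ofReal t • gaussianLaw d) (gibbs V)
      =ᵐ[volume] r := (absolutelyContinuous_tilted hint).ae_le hρ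
  rw [fisherInfo, if_pos hac]
  refine (iInf₂_le (gradient r) (hweak.congr_ae hρ'.symm)).trans ?_
  rw [lintegral_congr_ae (g := fun x => ‖(r x)⁻¹ • gradient r x‖ₑ ^ 2)
    (by filter_upwards [hac.ae_le hρ] with x hx; rw [hx]), hμ]
  refine (lintegral_withDensity_le_lintegral_mul _ hrm.ennreal_ofReal _).trans ?_
  calc _ ≤ ∫⁻ x, ENNReal.ofReal (t * R ^ 2) * ENNReal.ofReal (h x) ∂(gibbs V) := by
        refine lintegral_mono fun x => ?_
        rw [Pi.mul_apply, ← ofReal_norm, ← ENNReal.ofReal_pow (norm_nonneg _),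
          ← ENNReal.ofReal_mul (hr0 x), ← ENNReal.ofReal_mul (by positivity), hgr]
        refine ENNReal.ofReal_le_ofReal ?_
        have ha : 0 ≤ t * h x := mul_nonneg ht (hh0 x).le
        rw [norm_smul, norm_smul, Real.norm_eq_abs, Real.norm_eq_abs, abs_of_nonneg ha,
          abs_of_nonneg (inv_nonneg.2 (hr0 x))]
        have hle : t * h x ≤ r x := le_add_of_nonneg_left hs
        have hb : ‖gradient V x - x‖ ^ 2 ≤ R ^ 2 := pow_le_pow_left₀ (norm_nonneg _) (hR x) 2
        -- `r x = 0` is possible when `s = t = 0`; the left side then vanishes.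
        rcases (hr0 x).eq_or_lt with h0 | h0
        · rw [← h0, zero_mul]
          have := (hh0 x).le
          positivity
        · have e : r x * ((r x)⁻¹ * (t * h x * ‖gradient V x - x‖)) ^ 2 =
              (t * h x) / r x * ((t * h x) * ‖gradient V x - x‖ ^ 2) := by
            field_simp
          rw [e]
          calc _ ≤ 1 * ((t * h x) * R ^ 2) := by
                gcongr
                exact (div_le_one h0).2 hle
            _ = _ := by ring
    _ = ENNReal.ofReal (t * R ^ 2) := by
        rw [lintegral_const_mul _ hhm.ennreal_ofReal, ← setLIntegral_univ,
          ← withDensity_apply _ MeasurableSet.univ, ← hcW, measure_univ, mul_one]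

end

/-! ### Rejection sampling -/

section Rejection

variable {Y : Type*}

/-- The first component of the first pair whose second component is nonnegative, and the default
value `g` if there is no such pair. -/
def firstAccepted : (M : ℕ) → (Fin M → Y × ℝ) → Y → Y
  | 0, _, g => g
  | M + 1, y, g => if 0 ≤ (y 0).2 then (y 0).1 else firstAccepted M (fun j => y j.succ) g

variable [MeasurableSpace Y]

theorem measurable_firstAccepted (M : ℕ) :
    Measurable fun z : (Fin M → Y × ℝ) × Y => firstAccepted M z.1 z.2 := by
  induction M with
  | zero => exact measurable_snd
  | succ M ih =>
    refine Measurable.ite (measurableSet_le measurable_const (by fun_prop)) (by fun_prop) ?_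
    exact ih.comp (f := fun z : (Fin (M + 1) → Y × ℝ) × Y => ((fun j : Fin M => z.1 j.succ), z.2))
      (by fun_prop)

/-- One trial split by acceptance: the fallback is independent of the trial, so rejection
contributes its probability times the fallback law. -/
theorem map_ite_prod {W : Type*} [MeasurableSpace W] (η : Measure (Y × ℝ)) [IsProbabilityMeasure η]
    (ξ : Measure W) [IsProbabilityMeasure ξ] {k : W → Y} (hk : Measurable k) :
    (η.prod ξ).map (fun z => if 0 ≤ z.1.2 then z.1.1 else k z.2) =
      (η.restrict {p | 0 ≤ p.2}).map Prod.fst + η {p | 0 ≤ p.2}ᶜ • ξ.map k := by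
  have hS : MeasurableSet {p : Y × ℝ | 0 ≤ p.2} := measurableSet_le measurable_const measurable_snd
  have hF : Measurable fun z : (Y × ℝ) × W => if 0 ≤ z.1.2 then z.1.1 else k z.2 :=
    Measurable.ite (measurableSet_le measurable_const (by fun_prop)) (by fun_prop) (by fun_prop)
  ext A hA
  rw [Measure.map_apply hF hA, Measure.prod_apply (hF hA), ← lintegral_add_compl _ hS,
    Measure.add_apply, Measure.smul_apply, smul_eq_mul, Measure.map_apply measurable_fst hA,
    Measure.map_apply hk hA]
  congr 1
  · rw [← lintegral_indicator_one (measurable_fst hA)]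
    refine setLIntegral_congr_fun hS fun p hp => ?_
    have hp' : 0 ≤ p.2 := hp
    by_cases hpA : p.1 ∈ A <;> simp [Set.preimage, hp', hpA]
  · rw [mul_comm, ← setLIntegral_const]
    refine setLIntegral_congr_fun hS.compl fun p hp => ?_
    have hp' : ¬ 0 ≤ p.2 := hp
    simp [Set.preimage, hp']

/-- The law of the output of rejection sampling with at most `M` independent trials, where an
accepted trial has law `π`. -/
theorem map_firstAccepted (η : Measure (Y × ℝ)) [IsProbabilityMeasure η] (ν : Measure Y)
    [IsProbabilityMeasure ν] {π : Measure Y} {α : ℝ≥0∞}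
    (hη : (η.restrict {p | 0 ≤ p.2}).map Prod.fst = α • π) (M : ℕ) :
    ∃ s : ℝ≥0∞, ((Measure.pi fun _ : Fin M => η).prod ν).map (fun z => firstAccepted M z.1 z.2) =
      s • π + (η {p | 0 ≤ p.2}ᶜ) ^ M • ν := by
  induction M with
  | zero =>
    refine ⟨0, ?_⟩
    simp only [firstAccepted, zero_smul, zero_add, pow_zero, one_smul]
    exact measurePreserving_snd.map_eq
  | succ M ih =>
    obtain ⟨s, hs⟩ := ih
    have hpi := (measurePreserving_piFinSuccAbove (fun _ : Fin (M + 1) => η) 0).symm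
    -- The first of the `M + 1` trials is split off from the others and the fallback.
    have hmp : MeasurePreserving
        (fun z : (Y × ℝ) × ((Fin M → Y × ℝ) × Y) =>
          ((MeasurableEquiv.piFinSuccAbove (fun _ : Fin (M + 1) => Y × ℝ) 0).symm (z.1, z.2.1),
            z.2.2))
        (η.prod ((Measure.pi fun _ : Fin M => η).prod ν))
        ((Measure.pi fun _ : Fin (M + 1) => η).prod ν) :=
      (hpi.prod (MeasurePreserving.id ν)).comp
        (measurePreserving_prodAssoc η (Measure.pi fun _ : Fin M => η) ν).symm
    -- Either the first trial is accepted, or it is rejected and the remaining `M` trials decide.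
    refine ⟨α + η {p | 0 ≤ p.2}ᶜ * s, ?_⟩
    rw [← hmp.map_eq, Measure.map_map (measurable_firstAccepted _) hmp.measurable]
    have hcomp : ((fun z : (Fin (M + 1) → Y × ℝ) × Y => firstAccepted (M + 1) z.1 z.2) ∘
        fun z : (Y × ℝ) × ((Fin M → Y × ℝ) × Y) =>
          ((MeasurableEquiv.piFinSuccAbove (fun _ : Fin (M + 1) => Y × ℝ) 0).symm (z.1, z.2.1),
            z.2.2)) =
        fun z => if 0 ≤ z.1.2 then z.1.1 else firstAccepted M z.2.1 z.2.2 := by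
      funext z
      simp [firstAccepted, MeasurableEquiv.piFinSuccAbove_symm_apply, Fin.insertNthEquiv]
    rw [hcomp, map_ite_prod η _ (measurable_firstAccepted M), hη, hs, smul_add, smul_smul,
      smul_smul, ← add_assoc, ← add_smul, pow_succ']

/-- A measurable family of unnormalized densities can be sampled measurably in the parameter, for
those parameters for which the total mass is positive and finite. -/
theorem exists_measurable_sampler {α : Type*} [MeasurableSpace α] [StandardBorelSpace Y]
    [Nonempty Y] (ν : Measure Y) [SFinite ν] {q : α → Y → ℝ≥0∞}
    (hq : Measurable (Function.uncurry q)) :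
    ∃ f : α → unitInterval → Y, Measurable (Function.uncurry f) ∧
      ∀ a, ∫⁻ y, q a y ∂ν ≠ 0 → ∫⁻ y, q a y ∂ν ≠ ⊤ →
        volume.map (f a) = (∫⁻ y, q a y ∂ν)⁻¹ • ν.withDensity (q a) := by
  classical
  have hQ : Measurable fun a => ∫⁻ y, q a y ∂ν := hq.lintegral_prod_right'
  have hs : MeasurableSet {a | ∫⁻ y, q a y ∂ν ≠ 0 ∧ ∫⁻ y, q a y ∂ν ≠ ⊤} :=
    (hQ (measurableSet_singleton 0).compl).inter (hQ (measurableSet_singleton ⊤).compl)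
  have hg : Measurable (Function.uncurry fun a y => (∫⁻ y, q a y ∂ν)⁻¹ * q a y) :=
    (hQ.inv.comp measurable_fst).mul hq
  -- A Dirac mass at bad parameters makes `κ` a Markov kernel, which can then be realised as a
  -- measurable function of a uniform variable.
  let κ := ProbabilityTheory.Kernel.piecewise hs
    (ProbabilityTheory.Kernel.withDensity (ProbabilityTheory.Kernel.const α ν)
      fun a y => (∫⁻ y, q a y ∂ν)⁻¹ * q a y)
    (ProbabilityTheory.Kernel.const α (Measure.dirac (Classical.arbitrary Y)))
  have hκ : ∀ a, ∫⁻ y, q a y ∂ν ≠ 0 → ∫⁻ y, q a y ∂ν ≠ ⊤ →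
      κ a = (∫⁻ y, q a y ∂ν)⁻¹ • ν.withDensity (q a) := by
    intro a h0 h1
    have hmem : a ∈ {a | ∫⁻ y, q a y ∂ν ≠ 0 ∧ ∫⁻ y, q a y ∂ν ≠ ⊤} := ⟨h0, h1⟩
    rw [ProbabilityTheory.Kernel.piecewise_apply, if_pos hmem,
      ProbabilityTheory.Kernel.withDensity_apply _ hg, ProbabilityTheory.Kernel.const_apply]
    exact withDensity_smul _ (hq.comp measurable_prodMk_left)
  have : ProbabilityTheory.IsMarkovKernel κ := by
    refine ⟨fun a => ?_⟩
    by_cases ha : ∫⁻ y, q a y ∂ν ≠ 0 ∧ ∫⁻ y, q a y ∂ν ≠ ⊤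
    · rw [hκ a ha.1 ha.2]
      refine ⟨?_⟩
      rw [Measure.smul_apply, withDensity_apply _ MeasurableSet.univ, setLIntegral_univ,
        smul_eq_mul, ENNReal.inv_mul_cancel ha.1 ha.2]
    · have hmem : a ∉ {a | ∫⁻ y, q a y ∂ν ≠ 0 ∧ ∫⁻ y, q a y ∂ν ≠ ⊤} := ha
      rw [ProbabilityTheory.Kernel.piecewise_apply, if_neg hmem,
        ProbabilityTheory.Kernel.const_apply]
      infer_instance
  obtain ⟨f, hf, hfκ⟩ := ProbabilityTheory.Kernel.exists_measurable_map_eq_unitInterval κ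
  exact ⟨f, hf, fun a h0 h1 => (hfκ a).trans (hκ a h0 h1)⟩

/-- A proposal with density proportional to `q`, accepted with probability `e / q`, has on
acceptance the density proportional to `e`. -/
theorem map_restrict_trial (ν : Measure Y) [SFinite ν] {q e : Y → ℝ} (hq : Measurable q)
    (he : Measurable e) (hq0 : ∀ y, 0 < q y) (he0 : ∀ y, 0 ≤ e y) (heq : ∀ y, e y ≤ q y) (c : ℝ≥0∞)
    {f : unitInterval → Y} (hf : Measurable f)
    (hfq : volume.map f = c • ν.withDensity fun y => ENNReal.ofReal (q y)) :
    ((((volume : Measure unitInterval).prod (volume : Measure unitInterval)).map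
      fun p => (f p.1, e (f p.1) - (p.2 : ℝ) * q (f p.1))).restrict {p | 0 ≤ p.2}).map Prod.fst =
      c • ν.withDensity fun y => ENNReal.ofReal (e y) := by
  have hg : Measurable fun p : unitInterval × unitInterval =>
    (f p.1, e (f p.1) - (p.2 : ℝ) * q (f p.1)) := by fun_prop
  ext A hA
  have hS : MeasurableSet {p : Y × ℝ | 0 ≤ p.2} := measurableSet_le measurable_const measurable_snd
  have hT := (measurable_fst (β := ℝ) hA).inter hS
  rw [Measure.map_apply measurable_fst hA, Measure.restrict_apply (measurable_fst hA),
    Measure.map_apply hg hT, Measure.prod_apply (hg hT)]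
  -- For a fixed proposal `y = f u`, the uniform `w` passes the test `w * q y ≤ e y` with
  -- probability `e y / q y`.
  have hsec : ∀ u : unitInterval, (volume : Measure unitInterval)
      (Prod.mk u ⁻¹' ((fun p : unitInterval × unitInterval =>
        (f p.1, e (f p.1) - (p.2 : ℝ) * q (f p.1))) ⁻¹' (Prod.fst ⁻¹' A ∩ {p | 0 ≤ p.2}))) =
      A.indicator (fun y => ENNReal.ofReal (e y / q y)) (f u) := by
    intro u
    by_cases hu : f u ∈ A
    · have h1 : e (f u) / q (f u) ∈ unitInterval :=
        ⟨div_nonneg (he0 _) (hq0 _).le, (div_le_one (hq0 _)).2 (heq _)⟩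
      rw [Set.indicator_of_mem hu, ← unitInterval.volume_Iic ⟨_, h1⟩]
      congr 1
      ext w
      simp [hu, ← Subtype.coe_le_coe, le_div_iff₀ (hq0 (f u))]
    · rw [Set.indicator_of_notMem hu]
      convert! measure_empty (μ := (volume : Measure unitInterval))
      ext w
      simp [hu]
  have hm : Measurable fun y => ENNReal.ofReal (e y / q y) := by fun_prop
  simp_rw [hsec]
  rw [← lintegral_map (hm.indicator hA) hf, hfq, lintegral_smul_measure, lintegral_indicator hA,
    setLIntegral_withDensity_eq_setLIntegral_mul _ hq.ennreal_ofReal hm hA, Measure.smul_apply,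
    withDensity_apply _ hA]
  congr 1
  refine lintegral_congr fun y => ?_
  rw [Pi.mul_apply, ← ENNReal.ofReal_mul (hq0 y).le, mul_div_cancel₀ _ (hq0 y).ne']

end Rejection

/-! ### Rejection sampling as a query algorithm -/

section

variable {d n M : ℕ} {R : ℝ} {V : E d → ℝ}

theorem SamplingAlgorithm.transcript_apply {N : ℕ} (A : SamplingAlgorithm d N)
    (o : E d → ℝ × E d) (s : A.Seed) {k : ℕ} (i : Fin k) :
    A.transcript o s k i = o (A.query i (s, A.transcript o s i)) := by
  induction k with
  | zero => exact i.elim0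
  | succ k ih =>
    refine Fin.lastCases ?_ (fun j => ?_) i
    · simp only [transcript, Fin.snoc_last, Fin.val_last]
    · simp only [transcript, Fin.snoc_castSucc]
      exact ih j

/-- Query the points `x`, then make `M` rejection sampling trials: given the answers `a` at the
points `x`, the proposal is `f a u` for a uniform `u`, and it is accepted if
`w * q a (f a u) ≤ exp (-V (f a u))` for a uniform `w`. If no proposal is accepted, then output a
standard Gaussian. -/
def rejectionSampler (M : ℕ) (x : Fin n → E d) {f : (Fin n → ℝ × E d) → unitInterval → E d}
    (hf : Measurable (Function.uncurry f)) {q : (Fin n → ℝ × E d) → E d → ℝ}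
    (hq : Measurable (Function.uncurry q)) : SamplingAlgorithm d (n + M) where
  Seed := (Fin M → unitInterval × unitInterval) × E d
  seedLaw := (Measure.pi fun _ => volume.prod volume).prod (gaussianLaw d)
  query k p :=
    if h : k < n then x ⟨k, h⟩
    else if h' : k - n < M then
      f (fun i => p.2 ⟨i, i.2.trans_le (not_lt.1 h)⟩) (p.1.1 ⟨k - n, h'⟩).1
    -- Only reached for `k ≥ n + M`, beyond the queries that are used.
    else 0
  query_measurable k := by
    split_ifs with h h'
    · exact measurable_const
    · exact hf.comp (Measurable.prodMk (by fun_prop) (by fun_prop))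
    · exact measurable_const
  output p :=
    firstAccepted M (fun j =>
      (f (fun i => p.2 (Fin.castAdd M i)) (p.1.1 j).1,
        Real.exp (-(p.2 (Fin.natAdd n j)).1) - ((p.1.1 j).2 : ℝ) *
          q (fun i => p.2 (Fin.castAdd M i)) (f (fun i => p.2 (Fin.castAdd M i)) (p.1.1 j).1)))
      p.1.2
  output_measurable := by
    refine (measurable_firstAccepted M).comp (Measurable.prodMk ?_ (by fun_prop))
    refine measurable_pi_iff.2 fun j => ?_
    have ha : Measurable fun p : ((Fin M → unitInterval × unitInterval) × E d) ×
        (Fin (n + M) → ℝ × E d) => fun i : Fin n => p.2 (Fin.castAdd M i) := by fun_prop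
    have hX : Measurable fun p : ((Fin M → unitInterval × unitInterval) × E d) ×
        (Fin (n + M) → ℝ × E d) => f (fun i => p.2 (Fin.castAdd M i)) (p.1.1 j).1 :=
      hf.comp (ha.prodMk (by fun_prop))
    refine hX.prodMk (Measurable.sub (by fun_prop) (Measurable.mul (by fun_prop) ?_))
    exact hq.comp (ha.prodMk hX)

theorem run_rejectionSampler (x : Fin n → E d) {f : (Fin n → ℝ × E d) → unitInterval → E d}
    (hf : Measurable (Function.uncurry f)) {q : (Fin n → ℝ × E d) → E d → ℝ}
    (hq : Measurable (Function.uncurry q)) (o : E d → ℝ × E d)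
    (s : (Fin M → unitInterval × unitInterval) × E d) :
    (rejectionSampler M x hf hq).run o s = firstAccepted M (fun j =>
      (f (fun i => o (x i)) (s.1 j).1,
        Real.exp (-(o (f (fun i => o (x i)) (s.1 j).1)).1) - ((s.1 j).2 : ℝ) *
          q (fun i => o (x i)) (f (fun i => o (x i)) (s.1 j).1))) s.2 := by
  set A := rejectionSampler M x hf hq with hA
  have h1 : ∀ (k : ℕ) (i : Fin k) (h : (i : ℕ) < n), A.transcript o s k i = o (x ⟨i, h⟩) := by
    intro k i h
    refine (A.transcript_apply o s i).trans (congrArg o ?_)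
    change dite _ _ _ = _
    exact dif_pos h
  have h2 : (fun i => A.transcript o s (n + M) (Fin.castAdd M i)) = fun i => o (x i) :=
    funext fun i => h1 _ (Fin.castAdd M i) i.2
  have h3 : ∀ j : Fin M, A.transcript o s (n + M) (Fin.natAdd n j) =
      o (f (fun i => o (x i)) (s.1 j).1) := by
    intro j
    refine (A.transcript_apply o s _).trans (congrArg o ?_)
    have hk : ¬ ((Fin.natAdd n j : Fin (n + M)) : ℕ) < n := by simp
    have hk' : ((Fin.natAdd n j : Fin (n + M)) : ℕ) - n < M := by simp
    change dite _ _ _ = _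
    rw [dif_neg hk, dif_pos hk']
    have hj : (⟨((Fin.natAdd n j : Fin (n + M)) : ℕ) - n, hk'⟩ : Fin M) = j := by
      ext
      simp
    exact congrArg₂ f (funext fun i => h1 _ ⟨i, i.2.trans_le (not_lt.1 hk)⟩ i.2)
      (congrArg (fun m => (s.1 m).1) hj)
  change firstAccepted M (fun j =>
      (f (fun i => A.transcript o s (n + M) (Fin.castAdd M i)) (s.1 j).1,
        Real.exp (-(A.transcript o s (n + M) (Fin.natAdd n j)).1) - ((s.1 j).2 : ℝ) *
          q (fun i => A.transcript o s (n + M) (Fin.castAdd M i))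
            (f (fun i => A.transcript o s (n + M) (Fin.castAdd M i)) (s.1 j).1))) s.2 = _
  simp only [h2, h3]

theorem withDensity_exp_neg_eq_smul_gibbs (hV : Measurable V)
    (hint : Integrable fun x => Real.exp (-V x)) :
    volume.withDensity (fun x => ENNReal.ofReal (Real.exp (-V x))) =
      ENNReal.ofReal (∫ x, Real.exp (-V x)) • gibbs V := by
  have hZ := integral_exp_pos hint
  rw [gibbs, Measure.tilted, ← withDensity_smul _ (by fun_prop)]
  congr 1
  ext x
  rw [Pi.smul_apply, smul_eq_mul, ← ENNReal.ofReal_mul hZ.le, mul_div_cancel₀ _ hZ.ne']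

/-- With `Z = ∫ exp (-V)` and `Q = ∫ q`, a trial is accepted with probability `Z / Q`, and the
sandwich on `q` gives `Q ≤ e² Z`. -/
theorem outputLaw_rejectionSampler (x : Fin n → E d)
    {f : (Fin n → ℝ × E d) → unitInterval → E d}
    (hf : Measurable (Function.uncurry f)) {q : (Fin n → ℝ × E d) → E d → ℝ}
    (hq : Measurable (Function.uncurry q))
    (hfq : ∀ a, ∫⁻ y, ENNReal.ofReal (q a y) ≠ 0 → ∫⁻ y, ENNReal.ofReal (q a y) ≠ ⊤ →
      volume.map (f a) = (∫⁻ y, ENNReal.ofReal (q a y))⁻¹ •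
        volume.withDensity fun y => ENNReal.ofReal (q a y))
    (hV : OneSmooth V) (hint : Integrable fun x => Real.exp (-V x))
    (hlow : ∀ y, Real.exp (-V y) ≤ q (fun i => localOracle V (x i)) y)
    (hupp : ∀ y, q (fun i => localOracle V (x i)) y ≤ Real.exp 2 * Real.exp (-V y)) :
    ∃ s t : ℝ, 0 ≤ s ∧ 0 ≤ t ∧ t ≤ (1 - Real.exp (-2)) ^ M ∧
      (rejectionSampler M x hf hq).outputLaw (localOracle V) =
        ENNReal.ofReal s • gibbs V + ENNReal.ofReal t • gaussianLaw d := by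
  have hVm : Measurable V := hV.1.continuous.measurable
  have hZ := integral_exp_pos hint
  have : IsProbabilityMeasure (gibbs V) := isProbabilityMeasure_tilted hint
  set a := fun i => localOracle V (x i) with ha
  set Z := ∫ x, Real.exp (-V x) with hZdef
  set Q := ∫⁻ y, ENNReal.ofReal (q a y) with hQ
  have hZQ : ENNReal.ofReal Z ≤ Q := by
    rw [hZdef, ofReal_integral_eq_lintegral_ofReal hint
      (Filter.Eventually.of_forall fun x => (Real.exp_pos _).le)]
    exact lintegral_mono fun y => ENNReal.ofReal_le_ofReal (hlow y)
  have hQZ : Q ≤ ENNReal.ofReal (Real.exp 2 * Z) := by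
    rw [ENNReal.ofReal_mul (Real.exp_pos _).le, hZdef, ofReal_integral_eq_lintegral_ofReal hint
      (Filter.Eventually.of_forall fun x => (Real.exp_pos _).le),
      ← lintegral_const_mul _ (by fun_prop)]
    refine lintegral_mono fun y => ?_
    rw [← ENNReal.ofReal_mul (Real.exp_pos _).le]
    exact ENNReal.ofReal_le_ofReal (hupp y)
  have hQ0 : Q ≠ 0 := ((ENNReal.ofReal_pos.2 hZ).trans_le hZQ).ne'
  have hQt : Q ≠ ⊤ := (hQZ.trans_lt ENNReal.ofReal_lt_top).ne
  have hfa : Measurable (f a) := hf.comp measurable_prodMk_left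
  have hqa : Measurable (q a) := hq.comp measurable_prodMk_left
  set η : Measure (E d × ℝ) := (volume.prod volume).map fun p : unitInterval × unitInterval =>
    (f a p.1, Real.exp (-V (f a p.1)) - (p.2 : ℝ) * q a (f a p.1)) with hη
  have hgm : Measurable fun p : unitInterval × unitInterval =>
    (f a p.1, Real.exp (-V (f a p.1)) - (p.2 : ℝ) * q a (f a p.1)) := by fun_prop
  have hηp : IsProbabilityMeasure η := Measure.isProbabilityMeasure_map hgm.aemeasurable
  have htrial : (η.restrict {p | 0 ≤ p.2}).map Prod.fst = (Q⁻¹ * ENNReal.ofReal Z) • gibbs V := by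
    rw [mul_smul, ← withDensity_exp_neg_eq_smul_gibbs hVm hint]
    exact map_restrict_trial volume hqa (e := fun y => Real.exp (-V y)) (by fun_prop)
      (fun y => (Real.exp_pos _).trans_le (hlow y)) (fun y => (Real.exp_pos _).le) hlow Q⁻¹ hfa
      (hfq a hQ0 hQt)
  have hS : MeasurableSet {p : E d × ℝ | 0 ≤ p.2} :=
    measurableSet_le measurable_const measurable_snd
  -- Total masses in `htrial`.
  have hacc : η {p | 0 ≤ p.2} = Q⁻¹ * ENNReal.ofReal Z := by
    have h := congrArg (fun m : Measure (E d) => m Set.univ) htrial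
    simpa [Measure.map_apply measurable_fst MeasurableSet.univ] using h
  have hrej : η {p | 0 ≤ p.2}ᶜ ≤ ENNReal.ofReal (1 - Real.exp (-2)) := by
    rw [prob_compl_eq_one_sub hS, hacc, ENNReal.ofReal_sub _ (Real.exp_pos _).le,
      ENNReal.ofReal_one]
    refine tsub_le_tsub_left ?_ _
    rw [← ENNReal.div_eq_inv_mul, ENNReal.le_div_iff_mul_le (Or.inl hQ0) (Or.inl hQt)]
    refine (mul_le_mul_right hQZ _).trans ?_
    rw [← ENNReal.ofReal_mul (Real.exp_pos _).le, ← mul_assoc, ← Real.exp_add]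
    simp
  have hlaw : (rejectionSampler M x hf hq).outputLaw (localOracle V) =
      ((Measure.pi fun _ : Fin M => η).prod (gaussianLaw d)).map
        fun z => firstAccepted M z.1 z.2 := by
    have hmp : MeasurePreserving
        (Prod.map (fun (w : Fin M → unitInterval × unitInterval) (j : Fin M) =>
          (f a (w j).1, Real.exp (-V (f a (w j).1)) - ((w j).2 : ℝ) * q a (f a (w j).1)))
          (id : E d → E d))
        ((Measure.pi fun _ => volume.prod volume).prod (gaussianLaw d))
        ((Measure.pi fun _ : Fin M => η).prod (gaussianLaw d)) :=
      (measurePreserving_pi _ _ fun _ => ⟨hgm, rfl⟩).prod (MeasurePreserving.id _)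
    rw [← hmp.map_eq, Measure.map_map (measurable_firstAccepted M) hmp.measurable]
    have hrun : (rejectionSampler M x hf hq).run (localOracle V) = _ :=
      funext fun s => run_rejectionSampler x hf hq (localOracle V) s
    rw [SamplingAlgorithm.outputLaw, hrun]
    rfl
  obtain ⟨s, hs⟩ := map_firstAccepted η (gaussianLaw d) htrial M
  rw [← hlaw] at hs
  set β := η {p | 0 ≤ p.2}ᶜ with hβ
  -- The output law has mass `1`, so both weights are finite and can be read as reals.
  have hsum : s + β ^ M = 1 := by
    have := SamplingAlgorithm.isProbabilityMeasure_outputLaw (rejectionSampler M x hf hq)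
      (measurable_localOracle hV)
    have h := congrArg (fun m : Measure (E d) => m Set.univ) hs
    simpa using h.symm
  have hst : s ≠ ⊤ := fun h => by simp [h] at hsum
  have hβt : β ^ M ≠ ⊤ := fun h => by simp [h] at hsum
  have hpos : 0 ≤ 1 - Real.exp (-2) := by
    rw [sub_nonneg]; exact Real.exp_le_one_iff.2 (by norm_num)
  refine ⟨s.toReal, (β ^ M).toReal, ENNReal.toReal_nonneg, ENNReal.toReal_nonneg, ?_, ?_⟩
  · refine ENNReal.toReal_le_of_le_ofReal (pow_nonneg hpos M) ?_
    rw [ENNReal.ofReal_pow hpos]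
    exact pow_le_pow_left₀ bot_le hrej M
  · rw [ENNReal.ofReal_toReal hst, ENNReal.ofReal_toReal hβt, hs]

end

/-! ### The proposal density and the number of queries -/

section

variable {d n : ℕ} {R : ℝ}

/-- The first centre within distance `1` depends measurably on `y`. Outside the ball the index is
`0`, which exists because `0 < n`. -/
theorem exists_measurable_index (hn : 0 < n) {x : Fin n → E d}
    (hx : ∀ y, ‖y‖ ≤ R → ∃ i, ‖y - x i‖ ≤ 1) :
    ∃ idx : E d → Fin n, Measurable idx ∧ ∀ y, ‖y‖ ≤ R → ‖y - x (idx y)‖ ≤ 1 := by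
  classical
  let p : ℕ → E d → Prop := fun k y => R < ‖y‖ ∨ ∃ h : k < n, ‖y - x ⟨k, h⟩‖ ≤ 1
  have hp : ∀ y, ∃ k, k < n ∧ p k y := by
    intro y
    rcases lt_or_ge R ‖y‖ with hy | hy
    · exact ⟨0, hn, Or.inl hy⟩
    · obtain ⟨i, hi⟩ := hx y hy
      exact ⟨i, i.2, Or.inr ⟨i.2, hi⟩⟩
  have hp' : ∀ y, ∃ k, p k y := fun y => (hp y).imp fun k h => h.2
  have hlt : ∀ y, Nat.find (hp' y) < n := fun y => by
    obtain ⟨k, hk, hpk⟩ := hp y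
    exact (Nat.find_min' (hp' y) hpk).trans_lt hk
  have hmeas : Measurable fun y => Nat.find (hp' y) := by
    refine measurable_find hp' fun k => ?_
    refine (measurableSet_lt measurable_const measurable_norm).union ?_
    by_cases hk : k < n
    · simp only [hk, exists_true_left]
      exact measurableSet_le (by fun_prop) measurable_const
    · simp only [hk, IsEmpty.exists_iff]
      exact MeasurableSet.const False
  refine ⟨fun y => ⟨Nat.find (hp' y), hlt y⟩, measurable_to_countable' fun j => ?_, ?_⟩
  · convert! hmeas (measurableSet_singleton (j : ℕ)) using 1
    ext y
    simp [Fin.ext_iff]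
  · intro y hy
    rcases Nat.find_spec (hp' y) with h | ⟨_, h⟩
    · exact absurd hy (not_le.2 h)
    · exact h

open Classical in
/-- The unnormalized proposal density, from the answers `a` at the points `x`. -/
def proposalDensity (R : ℝ) (x : Fin n → E d) (idx : E d → Fin n) (a : Fin n → ℝ × E d)
    (y : E d) : ℝ :=
  -- The shift by `1`, the Taylor error, makes this an upper envelope of `exp (-V)`; together with
  -- the error it costs a factor of at most `e²`.
  if ‖y‖ ≤ R then Real.exp (1 - ((a (idx y)).1 + inner ℝ (a (idx y)).2 (y - x (idx y))))
  else Real.exp (-((1 / 2) * (‖y‖ - R) ^ 2))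

theorem measurable_proposalDensity (x : Fin n → E d) {idx : E d → Fin n} (hidx : Measurable idx) :
    Measurable (Function.uncurry (proposalDensity R x idx)) := by
  have h1 : Measurable fun p : (Fin n → ℝ × E d) × E d => p.1 (idx p.2) :=
    (measurable_from_prod_countable_left (f := fun z : (Fin n → ℝ × E d) × Fin n => z.1 z.2)
      fun i => measurable_pi_apply i).comp (measurable_fst.prodMk (hidx.comp measurable_snd))
  have h2 : Measurable fun p : (Fin n → ℝ × E d) × E d => x (idx p.2) :=
    (measurable_of_countable x).comp (hidx.comp measurable_snd)
  exact Measurable.ite (measurableSet_le (by fun_prop) measurable_const)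
    (by fun_prop) (by fun_prop)

theorem IsBoundedSupportPotential.proposalDensity_bounds {V : E d → ℝ}
    (hV : IsBoundedSupportPotential R V) {x : Fin n → E d} {idx : E d → Fin n}
    (hidx : ∀ y, ‖y‖ ≤ R → ‖y - x (idx y)‖ ≤ 1) (y : E d) :
    Real.exp (-V y) ≤ proposalDensity R x idx (fun i => localOracle V (x i)) y ∧
      proposalDensity R x idx (fun i => localOracle V (x i)) y ≤
        Real.exp 2 * Real.exp (-V y) := by
  rw [proposalDensity, ← Real.exp_add]
  split_ifs with hy
  · have h := abs_le.1 (hV.smooth.abs_sub_taylor_le (hidx y hy))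
    simp only [localOracle, Real.exp_le_exp]
    constructor <;> linarith
  · rw [hV.outside y (not_le.1 hy).le, Real.exp_le_exp, Real.exp_le_exp]
    constructor <;> linarith

theorem exists_samplingAlgorithm_of_cover (hd : 1 ≤ d) (hR : 0 ≤ R) (hn : 0 < n) {x : Fin n → E d}
    (hx : ∀ y, ‖y‖ ≤ R → ∃ i, ‖y - x i‖ ≤ 1) (M : ℕ) :
    ∃ A : SamplingAlgorithm d (n + M), ∀ V : E d → ℝ, IsBoundedSupportPotential R V →
      fisherInfo (A.outputLaw (localOracle V)) (gibbs V) ≤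
        ENNReal.ofReal ((1 - Real.exp (-2)) ^ M * R ^ 2) := by
  obtain ⟨idx, hidxm, hidx⟩ := exists_measurable_index hn hx
  have hq := measurable_proposalDensity (R := R) x hidxm
  obtain ⟨f, hf, hfq⟩ := exists_measurable_sampler (volume : Measure (E d))
    (q := fun a y => ENNReal.ofReal (proposalDensity R x idx a y)) hq.ennreal_ofReal
  refine ⟨rejectionSampler M x hf hq, fun V hV => ?_⟩
  obtain ⟨s, t, hs, ht, htM, hlaw⟩ := outputLaw_rejectionSampler (M := M) x hf hq hfq hV.smooth
    hV.integrable_exp_neg (fun y => (hV.proposalDensity_bounds hidx y).1)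
    (fun y => (hV.proposalDensity_bounds hidx y).2)
  rw [hlaw]
  refine (fisherInfo_mixture_gaussianLaw_le hV.smooth hV.integrable_exp_neg
    (hV.norm_gradient_sub_le hR hd) hs ht).trans (ENNReal.ofReal_le_ofReal ?_)
  gcongr

/-- The algorithm that makes no query and outputs a standard Gaussian. -/
def gaussianSampler (d : ℕ) : SamplingAlgorithm d 0 where
  Seed := E d
  seedLaw := gaussianLaw d
  query _ _ := 0
  query_measurable _ := measurable_const
  output p := p.1
  output_measurable := measurable_fst

theorem fisherInfo_gaussianSampler_le (hd : 1 ≤ d) (hR : 0 ≤ R) {V : E d → ℝ}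
    (hV : IsBoundedSupportPotential R V) :
    fisherInfo ((gaussianSampler d).outputLaw (localOracle V)) (gibbs V) ≤
      ENNReal.ofReal (R ^ 2) := by
  have h := fisherInfo_mixture_gaussianLaw_le hV.smooth hV.integrable_exp_neg
    (hV.norm_gradient_sub_le hR hd) le_rfl zero_le_one
  have hlaw : (gaussianSampler d).outputLaw (localOracle V) = gaussianLaw d := Measure.map_id
  simpa [hlaw] using h

/-- As `e² ≤ 8`, `1 - e⁻² ≤ 7/8 ≤ e^(-1/8)`. So `16 log (R/ε)` trials bring the factor down to
`(ε/R)²`. -/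
theorem rejection_pow_mul_sq_le {ε : ℝ} (hε : 0 < ε) (hR : 0 < R) :
    (1 - Real.exp (-2)) ^ ⌈16 * Real.log (R / ε)⌉₊ * R ^ 2 ≤ ε ^ 2 := by
  set M := ⌈16 * Real.log (R / ε)⌉₊
  have hM : 16 * Real.log (R / ε) ≤ M := Nat.le_ceil _
  have he : (1 / 8 : ℝ) ≤ Real.exp (-2) := by
    rw [Real.exp_neg, ← one_div]
    refine one_div_le_one_div_of_le (Real.exp_pos _) ?_
    rw [show (2 : ℝ) = 1 + 1 by norm_num, Real.exp_add]
    nlinarith [Real.exp_one_lt_d9, Real.exp_pos 1]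
  have h0 : 0 ≤ 1 - Real.exp (-2) := by
    rw [sub_nonneg]; exact Real.exp_le_one_iff.2 (by norm_num)
  have h1 : 1 - Real.exp (-2) ≤ Real.exp (-(1 / 8)) := by
    have := Real.add_one_le_exp (-(1 / 8 : ℝ))
    linarith
  calc (1 - Real.exp (-2)) ^ M * R ^ 2 ≤ Real.exp (-(1 / 8)) ^ M * R ^ 2 := by gcongr
    _ = Real.exp (-(M / 8)) * R ^ 2 := by rw [← Real.exp_nat_mul]; ring_nf
    _ ≤ Real.exp (-(2 * Real.log (R / ε))) * R ^ 2 := by gcongr; linarith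
    _ = ε ^ 2 := by
      rw [Real.exp_neg, two_mul, Real.exp_add, Real.exp_log (by positivity)]
      field_simp

/-- `log (R/ε) = log R + log (1/ε)`, where `log (1/ε) ≤ L` because `d ≥ 1`. For `R ≥ 1`, `1 + 2R ≤
3R` and `log R ≤ R - 1` is absorbed by `(3R)^d`. For `R < 1` one ball suffices and `log R ≤ 0`. -/
theorem exists_query_count_le (hd : 1 ≤ d) {ε : ℝ} (hε : 0 < ε) (hεR : ε < R) :
    ∃ n : ℕ, 0 < n ∧ (∃ x : Fin n → E d, ∀ y, ‖y‖ ≤ R → ∃ i, ‖y - x i‖ ≤ 1) ∧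
      ((n + ⌈16 * Real.log (R / ε)⌉₊ : ℕ) : ℝ) ≤
        18 * ((3 * R) ^ d + max (Real.log (Real.sqrt d / ε)) 0) := by
  have hR : 0 < R := hε.trans hεR
  have hsd : 1 ≤ Real.sqrt d := Real.one_le_sqrt.2 (by exact_mod_cast hd)
  set L := max (Real.log (Real.sqrt d / ε)) 0 with hL
  have hL0 : 0 ≤ L := le_max_right _ _
  have hLε : Real.log (1 / ε) ≤ L :=
    (Real.log_le_log (by positivity) (by gcongr)).trans (le_max_left _ _)
  have hlog0 : 0 ≤ Real.log (R / ε) := Real.log_nonneg ((one_le_div hε).2 hεR.le)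
  have hM := Nat.ceil_lt_add_one (show 0 ≤ 16 * Real.log (R / ε) by positivity)
  have hlogR : Real.log (R / ε) = Real.log R + Real.log (1 / ε) := by
    rw [← Real.log_mul hR.ne' (by positivity), mul_one_div]
  have hP0 : 0 ≤ (3 * R) ^ d := by positivity
  rcases le_or_gt 1 R with h1 | h1
  · obtain ⟨n, hn, hnle, hx⟩ := exists_cover_closedBall d hR.le
    refine ⟨n, hn, hx, ?_⟩
    have hn' : (n : ℝ) ≤ (3 * R) ^ d :=
      hnle.trans (pow_le_pow_left₀ (by linarith) (by linarith) d)
    have hP : 3 * R ≤ (3 * R) ^ d := le_self_pow₀ (by linarith) (by omega)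
    have := Real.log_le_sub_one_of_pos hR
    push_cast
    linarith
  · refine ⟨1, one_pos, ⟨fun _ => 0, fun y hy => ⟨0, by simpa using hy.trans h1.le⟩⟩, ?_⟩
    have hlog : Real.log R ≤ 0 := Real.log_nonpos hR.le h1.le
    -- This pays for the single centre and the rounding of the ceiling, whence `18 = 16 + 2`. If `3R
    -- < 1`, then `ε < R < 1/3` gives `1/ε > e`, so `L ≥ 1`.
    have hone : 1 ≤ (3 * R) ^ d + L := by
      rcases le_or_gt 1 (3 * R) with h3 | h3
      · have := one_le_pow₀ h3 (n := d)
        linarith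
      · have h4 : Real.exp 1 ≤ 1 / ε := by
          rw [le_div_iff₀ hε]
          nlinarith [Real.exp_one_lt_d9, Real.exp_pos 1]
        have := (Real.le_log_iff_exp_le (by positivity)).2 h4
        linarith
    push_cast
    linarith

end

end FisherSampling

end

theorem propositionD4 :
    ∃ c C : ℝ, 0 < c ∧ 0 < C ∧
      ∀ (d : ℕ) (R ε : ℝ), 1 ≤ d → 0 ≤ R → 0 < ε →
        ∃ N : ℕ, (N : ℝ) ≤ C * ((c * R) ^ d + max (Real.log (Real.sqrt d / ε)) 0) ∧
          ∃ A : FisherSampling.SamplingAlgorithm d N,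
            ∀ V : FisherSampling.E d → ℝ, FisherSampling.IsBoundedSupportPotential R V →
              IsProbabilityMeasure (A.outputLaw (FisherSampling.localOracle V)) ∧
                FisherSampling.fisherInfo (A.outputLaw (FisherSampling.localOracle V))
                    (FisherSampling.gibbs V) ^ (1 / 2 : ℝ) ≤ ENNReal.ofReal ε := by
  have hsqrt : ∀ {F : ℝ≥0∞} {ε b : ℝ}, 0 < ε → b ≤ ε ^ 2 → F ≤ ENNReal.ofReal b →
      F ^ (1 / 2 : ℝ) ≤ ENNReal.ofReal ε := by
    intro F ε b hε hb hF
    rw [one_div, ENNReal.rpow_inv_le_iff two_pos, ENNReal.ofReal_rpow_of_pos hε, Real.rpow_two]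
    exact hF.trans (ENNReal.ofReal_le_ofReal hb)
  refine ⟨3, 18, by norm_num, by norm_num, fun d R ε hd hR hε => ?_⟩
  -- For `R ≤ ε` the budget may be below one query, but the Gaussian alone has information at most
  -- `R² ≤ ε²`.
  rcases le_or_gt R ε with hRε | hεR
  · refine ⟨0, ?_, FisherSampling.gaussianSampler d, fun V hV =>
      ⟨FisherSampling.SamplingAlgorithm.isProbabilityMeasure_outputLaw _
        (FisherSampling.measurable_localOracle hV.smooth),
        hsqrt hε (pow_le_pow_left₀ hR hRε 2)
          (FisherSampling.fisherInfo_gaussianSampler_le hd hR hV)⟩⟩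
    rw [Nat.cast_zero]
    positivity
  · obtain ⟨n, hn, ⟨x, hx⟩, hN⟩ := FisherSampling.exists_query_count_le hd hε hεR
    obtain ⟨A, hA⟩ := FisherSampling.exists_samplingAlgorithm_of_cover hd hR hn hx
      ⌈16 * Real.log (R / ε)⌉₊
    exact ⟨_, hN, A, fun V hV =>
      ⟨FisherSampling.SamplingAlgorithm.isProbabilityMeasure_outputLaw _
        (FisherSampling.measurable_localOracle hV.smooth),
        hsqrt hε (FisherSampling.rejection_pow_mul_sq_le hε (hε.trans hεR)) (hA V hV)⟩⟩
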